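/- Let $n\ge 1$ and let $\mathcal{H}(n,\mathbb{C})$ be the group of all maps $z\mapsto \lambda z+a$ of $\mathbb{C}^n$ with $\lambda\in\mathbb{C}\setminus\{0\}$ and $a\in\mathbb{C}^n$; call $\lambda$ the ratio of such a map. Put $$H_2=\left(\tfrac{\pi}{2}+\pi\mathbb{Z}\right)\cup \pi\mathbb{Z},\qquad H_3=\left(\tfrac{\pi}{3}+\pi\mathbb{Z}\right)\cup\left(-\tfrac{\pi}{3}+\pi\mathbb{Z}\right)\cup \pi\mathbb{Z},$$ and let $\mathcal{SR}_n$ be the set of all maps $z\mapsto e^{i\theta}z+a$ of $\mathbb{C}^n$ with $\theta\in H_2\cup H_3$ and $a\in\mathbb{C}^n$. Let $G$ be a non-abelian subgroup of $\mathcal{H}(n,\mathbb{C})$ that has an element with a non-real ratio, and suppose that $G\not\subset\mathcal{SR}_n$. Then $G$ has no discrete orbit: for every $v\in\mathbb{C}^n$, the orbit $G(v)=\{f(v): f\in G\}$ is not discrete in the topology induced from $\mathbb{C}^n$. -/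

import Mathlib

namespace AffineHomothety

/-- The space of column vectors with `n` complex entries, with its usual topology. -/
abbrev Cn (n : ℕ) : Type := EuclideanSpace ℂ (Fin n)

/-- The group `H(n, ℂ)` of all maps `z ↦ c z + a` with `c ≠ 0`, under composition,
as a group of bijections of the space (it contains the translations, `c = 1`). -/
def homotheties (n : ℕ) : Subgroup (Equiv.Perm (Cn n)) where
  carrier := {f | ∃ c : ℂ, c ≠ 0 ∧ ∃ a : Cn n, ∀ z, f z = c • z + a}
  one_mem' := ⟨1, one_ne_zero, 0, fun z => by simp⟩
  mul_mem' := by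
    rintro f g ⟨c, hc, a, hf⟩ ⟨d, hd, b, hg⟩
    refine ⟨c * d, mul_ne_zero hc hd, c • b + a, fun z => ?_⟩
    rw [Equiv.Perm.mul_apply, hg, hf, smul_add, smul_smul, add_assoc]
  inv_mem' := by
    rintro f ⟨c, hc, a, hf⟩
    refine ⟨c⁻¹, inv_ne_zero hc, -(c⁻¹ • a), fun z => ?_⟩
    rw [Equiv.Perm.inv_eq_iff_eq, hf, smul_add, smul_neg, smul_smul, smul_smul,
      mul_inv_cancel₀ hc, one_smul, one_smul, neg_add_cancel_right]

/-- The angles `(π/2 + πℤ) ∪ πℤ`. -/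
def H₂ : Set ℝ :=
  {θ | ∃ k : ℤ, θ = Real.pi / 2 + k * Real.pi} ∪ {θ | ∃ k : ℤ, θ = k * Real.pi}

/-- The angles `(π/3 + πℤ) ∪ (-π/3 + πℤ) ∪ πℤ`. -/
def H₃ : Set ℝ :=
  {θ | ∃ k : ℤ, θ = Real.pi / 3 + k * Real.pi} ∪
    {θ | ∃ k : ℤ, θ = -(Real.pi / 3) + k * Real.pi} ∪ {θ | ∃ k : ℤ, θ = k * Real.pi}

/-- The maps `z ↦ exp(iθ) z + a` with `θ` in a given set of angles and `a` arbitrary. -/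
def rotationsWithAngleIn (n : ℕ) (H : Set ℝ) : Set (Equiv.Perm (Cn n)) :=
  {f | ∃ θ ∈ H, ∃ a : Cn n, ∀ z, f z = Complex.exp (θ * Complex.I) • z + a}

/-- The set of the rotations `z ↦ exp(iθ) z + a` with `θ` in `H₂` or in `H₃`. -/
def SR (n : ℕ) : Set (Equiv.Perm (Cn n)) :=
  rotationsWithAngleIn n H₂ ∪ rotationsWithAngleIn n H₃

/-- The set `Λ_G` of the ratios `c` of the elements `z ↦ c z + a` of `G`. -/
def ratios {n : ℕ} (G : Subgroup (Equiv.Perm (Cn n))) : Set ℂ :=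
  {c | c ≠ 0 ∧ ∃ f ∈ G, ∃ a : Cn n, ∀ z, f z = c • z + a}

end AffineHomothety

/-! Suppose some orbit is discrete. A commutator gives a nonzero translation in `G`, and
discreteness keeps the nonzero vectors of the translation group `T` away from 0. The multipliers of
`T` form a ring that contains every ratio `c` and its inverse, and whose nonzero elements have
modulus at least 1. So `|c| = 1`, and `c + c⁻¹ = 2 cos θ` is an integer, since its fractional part
lies in the ring. Hence `G` lies in `SR n`. -/

namespace AffineHomothety

/-- The vectors `a` such that the translation by `a` belongs to `G`. -/
def translations {n : ℕ} (G : Subgroup (Equiv.Perm (Cn n))) : AddSubgroup (Cn n) where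
  carrier := {a | ∃ f ∈ G, ∀ z, f z = z + a}
  zero_mem' := ⟨1, G.one_mem, fun z => by simp⟩
  add_mem' := by
    rintro a b ⟨f, hf, hfa⟩ ⟨g, hg, hgb⟩
    refine ⟨g * f, G.mul_mem hg hf, fun z => ?_⟩
    rw [Equiv.Perm.mul_apply, hfa, hgb, add_assoc]
  neg_mem' := by
    rintro a ⟨f, hf, hfa⟩
    refine ⟨f⁻¹, G.inv_mem hf, fun z => ?_⟩
    rw [Equiv.Perm.inv_eq_iff_eq, hfa, neg_add_cancel_right]

/-- The ring of the complex numbers that map an additive subgroup of `ℂⁿ` into itself. -/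
def multiplierRing {n : ℕ} (T : AddSubgroup (Cn n)) : Subring ℂ where
  carrier := {c | ∀ a ∈ T, c • a ∈ T}
  one_mem' := fun a ha => by simpa using ha
  zero_mem' := fun a _ => by simp
  mul_mem' := fun {c d} hc hd a ha => by
    rw [mul_smul]
    exact hc _ (hd _ ha)
  add_mem' := fun {c d} hc hd a ha => by
    rw [add_smul]
    exact T.add_mem (hc _ ha) (hd _ ha)
  neg_mem' := fun {c} hc a ha => by
    rw [neg_smul]
    exact T.neg_mem (hc _ ha)

variable {n : ℕ} {G : Subgroup (Equiv.Perm (Cn n))}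

theorem mem_multiplierRing {T : AddSubgroup (Cn n)} {c : ℂ} :
    c ∈ multiplierRing T ↔ ∀ a ∈ T, c • a ∈ T := Iff.rfl

/-- Conjugating the translation by `a` with `f` gives the translation by `c • a`. -/
theorem ratio_mem_multiplierRing {f : Equiv.Perm (Cn n)} (hf : f ∈ G) {c : ℂ} {b : Cn n}
    (hfc : ∀ z, f z = c • z + b) : c ∈ multiplierRing (translations G) := by
  rintro a ⟨g, hg, hga⟩
  refine ⟨f * g * f⁻¹, G.mul_mem (G.mul_mem hf hg) (G.inv_mem hf), fun z => ?_⟩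
  obtain ⟨w, rfl⟩ := f.surjective z
  rw [Equiv.Perm.mul_apply, Equiv.Perm.mul_apply, Equiv.Perm.inv_def, f.symm_apply_apply, hga, hfc, hfc,
    smul_add]
  abel

/-- A commutator of two affine homotheties is a translation. -/
theorem exists_translation_ne_zero (hG : G ≤ homotheties n)
    (h : ∃ f ∈ G, ∃ g ∈ G, f * g ≠ g * f) : ∃ a ∈ translations G, a ≠ 0 := by
  obtain ⟨f, hf, g, hg, hne⟩ := h
  obtain ⟨c, -, a, hfc⟩ := hG hf
  obtain ⟨d, -, b, hgd⟩ := hG hg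
  have key : ∀ z, (f * g) z = (g * f) z + ((c • b + a) - (d • a + b)) := fun z => by
    rw [Equiv.Perm.mul_apply, Equiv.Perm.mul_apply, hfc, hgd, hfc, hgd, smul_add, smul_add,
      smul_smul, smul_smul, mul_comm d c]
    abel
  refine ⟨(c • b + a) - (d • a + b), ⟨f * g * (g * f)⁻¹, G.mul_mem (G.mul_mem hf hg)
    (G.inv_mem (G.mul_mem hg hf)), fun z => ?_⟩, fun h0 => hne ?_⟩
  · obtain ⟨w, rfl⟩ := (g * f).surjective z
    rw [Equiv.Perm.mul_apply, Equiv.Perm.inv_def, Equiv.symm_apply_apply, key]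
  · ext1 z
    rw [key, h0, add_zero]

/-- A discrete orbit keeps the translations of the group away from zero. -/
theorem exists_pos_le_norm_of_isDiscrete_orbit {v : Cn n}
    (h : IsDiscrete (MulAction.orbit G v)) :
    ∃ ε > 0, ∀ a ∈ translations G, a ≠ 0 → ε ≤ ‖a‖ := by
  obtain ⟨ε, hε, hball⟩ := Metric.exists_ball_inter_eq_singleton_of_mem_discrete h
    (MulAction.mem_orbit_self (M := G) v)
  refine ⟨ε, hε, fun a ha ha0 => ?_⟩
  by_contra! hlt
  obtain ⟨f, hf, hfa⟩ := ha
  have hmem : v + a ∈ Metric.ball v ε ∩ MulAction.orbit G v :=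
    ⟨by simpa using hlt, ⟨⟨f, hf⟩, hfa v⟩⟩
  rw [hball, Set.mem_singleton_iff, add_eq_left] at hmem
  exact ha0 hmem

/-- Otherwise the vectors `c ^ k • a` would be nonzero elements of `T` tending to 0. -/
theorem one_le_norm_of_mem_multiplierRing {T : AddSubgroup (Cn n)} {ε : ℝ} (hε : 0 < ε)
    (hT : ∀ a ∈ T, a ≠ 0 → ε ≤ ‖a‖) {a : Cn n} (ha : a ∈ T) (ha0 : a ≠ 0) {c : ℂ}
    (hc : c ∈ multiplierRing T) (hc0 : c ≠ 0) : 1 ≤ ‖c‖ := by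
  by_contra! hlt
  obtain ⟨k, hk⟩ := exists_pow_lt_of_lt_one (div_pos hε (norm_pos_iff.2 ha0)) hlt
  have h := hT _ (mem_multiplierRing.1 (pow_mem hc k) a ha) (smul_ne_zero (pow_ne_zero k hc0) ha0)
  rw [norm_smul, norm_pow] at h
  exact absurd ((lt_div_iff₀ (norm_pos_iff.2 ha0)).1 hk) h.not_gt

/-- The crystallographic restriction, for angles. -/
theorem mem_angles_of_two_mul_cos_eq_intCast {θ : ℝ} {m : ℤ} (h : 2 * Real.cos θ = m) :
    θ ∈ H₂ ∪ H₃ := by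
  have h1 : (m : ℝ) ≤ 2 := by linarith [Real.cos_le_one θ]
  have h2 : (-2 : ℝ) ≤ m := by linarith [Real.neg_one_le_cos θ]
  have h1' : m ≤ 2 := by exact_mod_cast h1
  have h2' : -2 ≤ m := by exact_mod_cast h2
  have hcos (φ : ℝ) (hφ : 2 * Real.cos φ = m) :
      ∃ k : ℤ, θ = 2 * k * Real.pi + φ ∨ θ = 2 * k * Real.pi - φ :=
    Real.cos_eq_cos_iff.1 (by linarith)
  -- The values -2, -1, 0, 1, 2 correspond to the angles `π`, `2π/3`, `π/2`, `π/3`, 0, up to sign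
  -- and mod `2π`.
  interval_cases m
  · obtain ⟨k, hk | hk⟩ := hcos Real.pi (by norm_num)
    · exact .inl (.inr ⟨2 * k + 1, by push_cast; linarith⟩)
    · exact .inl (.inr ⟨2 * k - 1, by push_cast; linarith⟩)
  · obtain ⟨k, hk | hk⟩ := hcos (Real.pi - Real.pi / 3)
      (by rw [Real.cos_pi_sub, Real.cos_pi_div_three]; norm_num)
    · exact .inr (.inl (.inr ⟨2 * k + 1, by push_cast; linarith⟩))
    · exact .inr (.inl (.inl ⟨2 * k - 1, by push_cast; linarith⟩))
  · obtain ⟨k, hk | hk⟩ := hcos (Real.pi / 2) (by norm_num)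
    · exact .inl (.inl ⟨2 * k, by push_cast; linarith⟩)
    · exact .inl (.inl ⟨2 * k - 1, by push_cast; linarith⟩)
  · obtain ⟨k, hk | hk⟩ := hcos (Real.pi / 3) (by norm_num)
    · exact .inr (.inl (.inl ⟨2 * k, by push_cast; linarith⟩))
    · exact .inr (.inl (.inr ⟨2 * k, by push_cast; linarith⟩))
  · obtain ⟨k, hk | hk⟩ := hcos 0 (by norm_num)
    · exact .inl (.inr ⟨2 * k, by push_cast; linarith⟩)
    · exact .inl (.inr ⟨2 * k, by push_cast; linarith⟩)

/-- A group of affine homotheties that contains a nonzero translation and has a discrete orbit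
consists of rotations with angles in `H₂ ∪ H₃`. -/
theorem mem_SR_of_isDiscrete_orbit (hG : G ≤ homotheties n) {a : Cn n}
    (ha : a ∈ translations G) (ha0 : a ≠ 0) {v : Cn n} (hv : IsDiscrete (MulAction.orbit G v))
    {f : Equiv.Perm (Cn n)} (hf : f ∈ G) : f ∈ SR n := by
  obtain ⟨ε, hε, hT⟩ := exists_pos_le_norm_of_isDiscrete_orbit hv
  have hone {c : ℂ} (hc : c ∈ multiplierRing (translations G)) (hc0 : c ≠ 0) : 1 ≤ ‖c‖ :=
    one_le_norm_of_mem_multiplierRing hε hT ha ha0 hc hc0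
  obtain ⟨c, hc0, b, hfc⟩ := hG hf
  have hc := ratio_mem_multiplierRing hf hfc
  have hcinv : c⁻¹ ∈ multiplierRing (translations G) :=
    ratio_mem_multiplierRing (b := -(c⁻¹ • b)) (G.inv_mem hf) fun z => by
      rw [Equiv.Perm.inv_eq_iff_eq, hfc, smul_add, smul_neg, smul_inv_smul₀ hc0,
        smul_inv_smul₀ hc0, neg_add_cancel_right]
  have hnorm : ‖c‖ = 1 := by
    refine le_antisymm ?_ (hone hc hc0)
    have h := hone hcinv (inv_ne_zero hc0)
    rw [norm_inv] at h
    exact (one_le_inv₀ (norm_pos_iff.2 hc0)).1 h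
  have hexp : c = Complex.exp (c.arg * Complex.I) := by
    simpa [hnorm] using (Complex.norm_mul_exp_arg_mul_I c).symm
  have htrace : c + c⁻¹ = ((2 * Real.cos c.arg : ℝ) : ℂ) := by
    push_cast
    rw [Complex.two_cos, neg_mul, Complex.exp_neg, ← hexp]
  -- The fractional part is `c + c⁻¹` minus an integer, hence a multiplier of modulus below 1, so it
  -- vanishes.
  have hfract : Int.fract (2 * Real.cos c.arg) = 0 := by
    by_contra hne
    have hmem : ((Int.fract (2 * Real.cos c.arg) : ℝ) : ℂ) ∈ multiplierRing (translations G) := by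
      rw [Int.fract, Complex.ofReal_sub, ← htrace, Complex.ofReal_intCast]
      exact sub_mem (add_mem hc hcinv) (intCast_mem _ _)
    have h := hone hmem (Complex.ofReal_ne_zero.2 hne)
    rw [Complex.norm_of_nonneg (Int.fract_nonneg _)] at h
    exact h.not_gt (Int.fract_lt_one _)
  obtain ⟨m, hm⟩ := Int.fract_eq_zero_iff.1 hfract
  have hform : ∀ z, f z = Complex.exp (c.arg * Complex.I) • z + b := hexp ▸ hfc
  rcases mem_angles_of_two_mul_cos_eq_intCast hm.symm with h | h
  · exact .inl ⟨c.arg, h, b, hform⟩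
  · exact .inr ⟨c.arg, h, b, hform⟩

end AffineHomothety

theorem corollary1p3 (n : ℕ)
    (G : Subgroup (Equiv.Perm (AffineHomothety.Cn n)))
    (hG : G ≤ AffineHomothety.homotheties n)
    (hnonabelian : ∃ f ∈ G, ∃ g ∈ G, f * g ≠ g * f)
    (hratio : (AffineHomothety.ratios G \ Set.range (fun x : ℝ => (x : ℂ))).Nonempty)
    (hSR : ((G : Set (Equiv.Perm (AffineHomothety.Cn n))) \ AffineHomothety.SR n).Nonempty) :
    ∀ v : AffineHomothety.Cn n, ¬ IsDiscrete (MulAction.orbit G v) := by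
  intro v hv
  obtain ⟨a, ha, ha0⟩ := AffineHomothety.exists_translation_ne_zero hG hnonabelian
  obtain ⟨f, hf, hfSR⟩ := hSR
  exact hfSR (AffineHomothety.mem_SR_of_isDiscrete_orbit hG ha ha0 hv hf)
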